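/- Consider the system $\dot x = f(x)+g(x)u+w(x)$, $x\in\mathbb R^{n}$, $u\in\mathbb R^{m}$, where $f$ and $g$ are known, with polynomial entries, and $w$ is unknown. Let $(\Omega,P)$ be a probability space carrying all randomness (measurement noise, and possibly $w$ itself); the data, $w$, $q$ and the objects $V,\kappa,\gamma$ below may be random, and every assumption below on a realization is meant to hold almost surely. Standing assumptions. (1) $f(0)=w(0)=0$. (2) $f,g$ are polynomial. (3) On a region $\mathcal X\ni 0$ there is, for a given $\epsilon>0$, a polynomial vector $q$ with $\|w(x)-q(x)\|\le\epsilon$ for all $x\in\mathcal X$. (4) There are $N$ measurements $(x^{(j)},u^{(j)},\dot x^{(j)})$, where each coordinate of $\dot x^{(j)}$ differs from that of $f(x^{(j)})+g(x^{(j)})u^{(j)}+w(x^{(j)})$ by at most $\sigma_n$. Model. For each $i$ let $k_i(x,y)$ be a symmetric positive semidefinite kernel that is polynomial in $x$ and $y$, let $\lambda>0$ be the regression noise parameter (for instance $\lambda=\sigma_n$), let $K_i$ be the Gram matrix $(k_i(x^{(j)},x^{(l)}))_{j,l}$, $k_{*,i}(x)=(k_i(x,x^{(j)}))_j$, and let $y_i$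 be the vector of labels $(\dot x^{(j)}-f(x^{(j)})-g(x^{(j)})u^{(j)})_i$. Put $m_i(x)=y_i^\top(K_i+\lambda I)^{-1}k_{*,i}(x)$ and $\sigma_i(x)=\sqrt{k_i(x,x)-k_{*,i}(x)^\top(K_i+\lambda I)^{-1}k_{*,i}(x)}$. Let $\delta\in(0,1)$ and $\beta_{N,i}=2\|q_i\|_{k_i}^2+300\,\gamma_{N,i}\log^3(N/\delta)$, where $\|\cdot\|_{k_i}$ is the norm of the reproducing kernel Hilbert space of $k_i$ ($\infty$ outside that space) and $\gamma_{N,i}=\sup_{z_1,\dots,z_N\in\mathcal X}\tfrac12\log\det\bigl(I+\lambda^{-1}(k_i(z_j,z_l))_{j,l}\bigr)$ is the maximal mutual information of $N$ samples. Let $\eta\ge 0$, $\gamma>0$, $\kappa:\mathbb R^n\to\mathbb R^m$, and let $V:\mathbb R^n\to\mathbb R$ be $C^1$ with $V(0)=0$ and $V(x)>0$ for $x\ne0$. Suppose that $\mathcal R=\{x: V(x)\le\gamma\}$ is bounded, that the closed-loop vector field $f+g\kappa+w$ is continuous on $\mathcal R$, and that $$\tfrac{\partial V(x)}{\partial x}\cdot\bigl(f(x)+g(x)\kappa(x)+m(x)+d(x)\bigr)<0\quad\text{for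 all }x\in\mathcal R\setminus\{0\}$$ for every $d:\mathbb R^n\to\mathbb R^n$ with $-\eta\sigma_i(x)\le d_i(x)\le\eta\sigma_i(x)$ for all $i$ and $x$. Suppose that the Gaussian process confidence bound of Srinivas et al. holds for $w$ with confidence $\delta$, with $\eta$ bounding $\sqrt{\beta_N}$: with probability at least $1-\delta$, simultaneously for all $i=1,\dots,n$, $\sqrt{\beta_{N,i}}\le\eta$ and $|w_i(x)-m_i(x)|\le\sqrt{\beta_{N,i}}\,\sigma_i(x)$ for all $x\in\mathcal R$. Then, with probability at least $1-\delta$, $\mathcal R$ is an inner approximation of the region of attraction of the true closed loop $\dot x=f(x)+g(x)\kappa(x)+w(x)$: the origin is an asymptotically stable equilibrium, from every point of $\mathcal R$ a solution exists on $[0,\infty)$, every solution from it on a bounded interval $[0,T)$ can be continued to $[0,\infty)$, and every solution from it on $[0,\infty)$ converges to $0$. -/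

import Mathlib

open MeasureTheory Filter Topology Set
open scoped NNReal ENNReal Matrix

noncomputable section

namespace GPROA

/-- The space `ℝⁿ` with its Euclidean norm. -/
abbrev Vec (n : ℕ) := EuclideanSpace ℝ (Fin n)

/-! ### The control system -/

/-- The vector field `ℝⁿ → ℝᵏ` given by a vector of polynomials. -/
def polyField {n k : ℕ} (p : Fin k → MvPolynomial (Fin n) ℝ) (x : Vec n) : Vec k :=
  WithLp.toLp 2 fun i => MvPolynomial.eval (fun j => x j) (p i)

/-- The matrix-vector product `g(x) u` for a matrix `g` of polynomials. -/
def inputTerm {n m : ℕ} (g : Matrix (Fin n) (Fin m) (MvPolynomial (Fin n) ℝ))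
    (x : Vec n) (u : Vec m) : Vec n :=
  WithLp.toLp 2 fun i => ∑ j, MvPolynomial.eval (fun l => x l) (g i j) * u j

/-- The right-hand side `f(x) + g(x) u + w(x)` of the controlled system. -/
def openLoop {n m : ℕ} (f : Fin n → MvPolynomial (Fin n) ℝ)
    (g : Matrix (Fin n) (Fin m) (MvPolynomial (Fin n) ℝ)) (w : Vec n → Vec n)
    (x : Vec n) (u : Vec m) : Vec n :=
  polyField f x + inputTerm g x u + w x

/-- The closed-loop vector field `f(x) + g(x) κ(x) + w(x)`. -/
def closedLoop {n m : ℕ} (f : Fin n → MvPolynomial (Fin n) ℝ)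
    (g : Matrix (Fin n) (Fin m) (MvPolynomial (Fin n) ℝ)) (w : Vec n → Vec n)
    (κ : Vec n → Vec m) (x : Vec n) : Vec n :=
  openLoop f g w x (κ x)

/-! ### Region of attraction of the origin -/

/-- `x` solves `ẋ = F(x)` on the time interval `J` with `x(0) = x₀`. -/
def IsSolutionFrom {n : ℕ} (F : Vec n → Vec n) (x₀ : Vec n) (J : Set ℝ) (x : ℝ → Vec n) : Prop :=
  x 0 = x₀ ∧ IsIntegralCurveOn x (fun _ => F) J

/-- The region of attraction of the origin, for a vector field that need not have unique
solutions: the initial states from which a solution on `[0, ∞)` exists, from which every solution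
on a bounded interval `[0, T)` can be continued to `[0, ∞)`, and from which all solutions on
`[0, ∞)` converge to the origin. -/
def regionOfAttraction {n : ℕ} (F : Vec n → Vec n) : Set (Vec n) :=
  {x₀ | (∃ x, IsSolutionFrom F x₀ (Ici 0) x) ∧
    (∀ T : ℝ, 0 < T → ∀ x, IsSolutionFrom F x₀ (Ico 0 T) x →
      ∃ y, IsSolutionFrom F x₀ (Ici 0) y ∧ EqOn x y (Ico 0 T)) ∧
    ∀ x, IsSolutionFrom F x₀ (Ici 0) x → Tendsto x atTop (𝓝 0)}

/-- Lyapunov stability of the origin. -/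
def IsLyapunovStable {n : ℕ} (F : Vec n → Vec n) : Prop :=
  ∀ ε : ℝ, 0 < ε → ∃ ρ : ℝ, 0 < ρ ∧ ∀ x₀ : Vec n, ‖x₀‖ < ρ → ∀ T : ℝ, 0 < T →
    ∀ x, IsSolutionFrom F x₀ (Ico 0 T) x → ∀ t ∈ Ico 0 T, ‖x t‖ < ε

/-- The origin is an asymptotically stable equilibrium of `ẋ = F(x)`. -/
def IsAsymptoticallyStable {n : ℕ} (F : Vec n → Vec n) : Prop :=
  F 0 = 0 ∧ IsLyapunovStable F ∧ regionOfAttraction F ∈ 𝓝 0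

/-- `R` is an inner approximation of the region of attraction of the origin, which is an
asymptotically stable equilibrium. -/
def IsROAInnerApprox {n : ℕ} (F : Vec n → Vec n) (R : Set (Vec n)) : Prop :=
  IsAsymptoticallyStable F ∧ R ⊆ regionOfAttraction F

/-! ### Polynomial kernels and Gaussian process regression -/

/-- A real-valued kernel, as the matrix of operators on `ℝ` that Mathlib's reproducing kernel
Hilbert spaces are built from. -/
def opKernel {X : Type*} (k : X → X → ℝ) : Matrix X X (ℝ →L[ℝ] ℝ) :=
  Matrix.of fun x y => k x y • ContinuousLinearMap.id ℝ ℝ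

/-- A polynomial kernel on `ℝⁿ`: a symmetric positive semidefinite kernel `k(x, y)` that is a
polynomial in the entries of `x` and `y`. -/
structure PolyKernel (n : ℕ) where
  toFun : Vec n → Vec n → ℝ
  polynomial : ∃ P : MvPolynomial (Fin n ⊕ Fin n) ℝ, ∀ x y,
    toFun x y = MvPolynomial.eval (Sum.elim (fun j => x j) (fun j => y j)) P
  posSemidef : (Matrix.of toFun : Matrix (Vec n) (Vec n) ℝ).PosSemidef

theorem opKernel_posSemidef {X : Type*} {k : X → X → ℝ}
    (hk : (Matrix.of k : Matrix X X ℝ).PosSemidef) : (opKernel k).PosSemidef := by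
  refine ((RKHS.posSemidef_tfae (K := opKernel k)).out 0 2).mpr (And.intro ?_ fun v => ?_)
  · ext x y
    have h := hk.1.apply x y
    simp only [Matrix.of_apply, star_trivial] at h
    have hid : star (ContinuousLinearMap.id ℝ ℝ) = ContinuousLinearMap.id ℝ ℝ :=
      star_one (ℝ →L[ℝ] ℝ)
    simp [opKernel, Matrix.conjTranspose_apply, h, hid]
  · have h := hk.2 v
    have e : (v.sum fun x w => v.sum fun x' w' => inner ℝ (opKernel k x' x w) w') =
        v.sum fun i xi => v.sum fun j xj => star xi * (Matrix.of k : Matrix X X ℝ) i j * xj := by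
      rw [Finsupp.sum_comm]
      refine Finsupp.sum_congr fun i _ => Finsupp.sum_congr fun j _ => ?_
      simp [opKernel]
      ring
    rw [e]
    exact h

/-- The squared norm of `h` in the reproducing kernel Hilbert space of `k`, equal to `∞` when `h`
does not belong to that space. -/
def rkhsNormSq {n : ℕ} (k : PolyKernel n) (h : Vec n → ℝ) : ℝ≥0∞ :=
  haveI : Fact (opKernel k.toFun).PosSemidef := ⟨opKernel_posSemidef k.posSemidef⟩
  ⨅ φ : {φ : RKHS.OfKernel (opKernel k.toFun) // (φ : Vec n → ℝ) = h}, ‖φ.1‖ₑ ^ 2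

/-- The Gram matrix `K` of the kernel at the sample points. -/
def gram {n N : ℕ} (k : PolyKernel n) (X : Fin N → Vec n) : Matrix (Fin N) (Fin N) ℝ :=
  Matrix.of fun i j => k.toFun (X i) (X j)

/-- The vector `k_*` with entries `k(x, x⁽ⁱ⁾)`. -/
def kStar {n N : ℕ} (k : PolyKernel n) (X : Fin N → Vec n) (x : Vec n) : Fin N → ℝ :=
  fun i => k.toFun x (X i)

/-- The posterior mean `yᵀ (K + λ I)⁻¹ k_*` of the zero-mean Gaussian process with kernel `k`. -/
def gpMean {n N : ℕ} (k : PolyKernel n) (lam : ℝ) (X : Fin N → Vec n) (y : Fin N → ℝ)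
    (x : Vec n) : ℝ :=
  y ⬝ᵥ ((gram k X + lam • (1 : Matrix (Fin N) (Fin N) ℝ))⁻¹ *ᵥ kStar k X x)

/-- The posterior variance `k(x, x) - k_*ᵀ (K + λ I)⁻¹ k_*`. -/
def gpVar {n N : ℕ} (k : PolyKernel n) (lam : ℝ) (X : Fin N → Vec n) (x : Vec n) : ℝ :=
  k.toFun x x -
    kStar k X x ⬝ᵥ ((gram k X + lam • (1 : Matrix (Fin N) (Fin N) ℝ))⁻¹ *ᵥ kStar k X x)

/-- The posterior standard deviation. -/
def gpStd {n N : ℕ} (k : PolyKernel n) (lam : ℝ) (X : Fin N → Vec n) (x : Vec n) : ℝ :=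
  √(gpVar k lam X x)

/-- The maximal mutual information `sup ½ log det (I + λ⁻¹ K)` between the Gaussian process and
`N` samples of it taken in `D` under Gaussian noise of variance `λ`. -/
def maxInfoGain {n : ℕ} (k : PolyKernel n) (lam : ℝ) (D : Set (Vec n)) (N : ℕ) : ℝ≥0∞ :=
  ⨆ X : Fin N → D, ENNReal.ofReal
    (Real.log (1 + lam⁻¹ • gram k (fun j => (X j : Vec n))).det / 2)

/-- The square root of `β_N = 2 ‖h‖_k² + 300 γ_N log³(N / δ)`. -/
def sqrtBeta {n : ℕ} (k : PolyKernel n) (lam : ℝ) (D : Set (Vec n)) (N : ℕ) (δ : ℝ)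
    (h : Vec n → ℝ) : ℝ≥0∞ :=
  (2 * rkhsNormSq k h +
    ENNReal.ofReal (300 * Real.log (N / δ) ^ 3) * maxInfoGain k lam D N) ^ (1 / 2 : ℝ)

/-- The labels for the unknown term: measured velocity minus `f(x) + g(x) u`. -/
def label {n m N : ℕ} (f : Fin n → MvPolynomial (Fin n) ℝ)
    (g : Matrix (Fin n) (Fin m) (MvPolynomial (Fin n) ℝ))
    (X : Fin N → Vec n) (U : Fin N → Vec m) (Y : Fin N → Vec n) (i : Fin n) (j : Fin N) : ℝ :=
  (Y j - polyField f (X j) - inputTerm g (X j) (U j)) i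

/-- The vector `m(x)` of posterior means, one Gaussian process per coordinate. -/
def postMean {n m N : ℕ} (f : Fin n → MvPolynomial (Fin n) ℝ)
    (g : Matrix (Fin n) (Fin m) (MvPolynomial (Fin n) ℝ)) (k : Fin n → PolyKernel n) (lam : ℝ)
    (X : Fin N → Vec n) (U : Fin N → Vec m) (Y : Fin N → Vec n) (x : Vec n) : Vec n :=
  WithLp.toLp 2 fun i => gpMean (k i) lam X (label f g X U Y i) x

/-! ### Hypotheses -/

/-- The standing assumptions on the system, its approximation and the measurements. -/
structure StandingAssumptions {n m N : ℕ} (f : Fin n → MvPolynomial (Fin n) ℝ)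
    (g : Matrix (Fin n) (Fin m) (MvPolynomial (Fin n) ℝ)) (w : Vec n → Vec n)
    (D : Set (Vec n)) (ε : ℝ) (q : Fin n → MvPolynomial (Fin n) ℝ) (σn : ℝ)
    (X : Fin N → Vec n) (U : Fin N → Vec m) (Y : Fin N → Vec n) : Prop where
  /-- The origin is an equilibrium for `u = 0`. -/
  f_zero : polyField f 0 = 0
  w_zero : w 0 = 0
  /-- On the region `D` the unknown term is approximated by the polynomial `q` up to `ε`. -/
  zero_mem : (0 : Vec n) ∈ D
  approx : ∀ x ∈ D, ‖w x - polyField q x‖ ≤ ε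
  /-- The noise in the measurements `Y` of the velocity is bounded by `σn`. -/
  noise : ∀ j i, |(Y j - openLoop f g w (X j) (U j)) i| ≤ σn

/-- `V` is a `C¹` positive definite function with bounded sublevel set `{V ≤ γ}` that decreases
there, off the origin, along `f + gκ + μ + d` for every `d` with `-ησ ≤ d ≤ ησ`. -/
structure IsRobustLyapunov {n m : ℕ} (f : Fin n → MvPolynomial (Fin n) ℝ)
    (g : Matrix (Fin n) (Fin m) (MvPolynomial (Fin n) ℝ)) (μ : Vec n → Vec n)
    (σ : Fin n → Vec n → ℝ) (η : ℝ≥0) (κ : Vec n → Vec m) (V : Vec n → ℝ) (γ : ℝ) : Prop where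
  contDiff : ContDiff ℝ 1 V
  zero : V 0 = 0
  pos : ∀ x, x ≠ 0 → 0 < V x
  bounded : Bornology.IsBounded {x | V x ≤ γ}
  decrease : ∀ d : Vec n → Vec n, (∀ x i, -(η * σ i x) ≤ d x i ∧ d x i ≤ η * σ i x) →
    ∀ x, V x ≤ γ → x ≠ 0 →
      fderiv ℝ V x (polyField f x + inputTerm g x (κ x) + μ x + d x) < 0

/-- `√β_N` is at most `η` for every coordinate, and the confidence bound
`|w_i(x) - m_i(x)| ≤ √β_N σ_i(x)` holds for every coordinate and every `x ∈ R`. -/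
def ConfidenceBound {n : ℕ} (w μ : Vec n → Vec n) (σ : Fin n → Vec n → ℝ)
    (sβ : Fin n → ℝ≥0∞) (η : ℝ≥0) (R : Set (Vec n)) : Prop :=
  ∀ i, sβ i ≤ η ∧ ∀ x ∈ R, |w x i - μ x i| ≤ (sβ i).toReal * σ i x

/-- The property `Q` holds with probability at least `p`. -/
def HoldsWithProbGE {Ω : Type*} [MeasurableSpace Ω] (P : Measure Ω) (p : ℝ) (Q : Ω → Prop) :
    Prop :=
  ∃ S : Set Ω, MeasurableSet S ∧ ENNReal.ofReal p ≤ P S ∧ ∀ ω ∈ S, Q ω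

end GPROA

end

noncomputable section

namespace GPROA

/-! ### Peano's existence theorem for bounded continuous vector fields -/

section Peano

variable {E : Type*} [NormedAddCommGroup E]

/-! On the confidence event, the model error `w - m` restricted to the sublevel set is an admissible
disturbance, so `V` is a strict Lyapunov function of the true closed loop
(`IsRobustLyapunov.isStrictLyapunov`). The rest is deterministic
(`IsStrictLyapunov.isROAInnerApprox`), and the almost sure hypotheses cost only a null set
(`HoldsWithProbGE.mono_ae`). The closed-loop field is only known to be continuous, and only on the
sublevel set, so solutions may fail to be unique and Picard–Lindelöf is replaced by Peano's theorem.
Its solution is a limit of solutions of delayed equations, which are uniformly Lipschitz and hence,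
by Arzelà–Ascoli, lie in a compact set. Strict decrease of `V` makes sublevel sets invariant: this
confines solutions to the region where the field is controlled, gives stability, and traps a
solution once it has come near the origin. -/

theorem isCompact_setOf_lipschitzWith [ProperSpace E] (x₀ : E) (M : ℝ≥0) :
    IsCompact {x : C(ℝ, E) | x 0 = x₀ ∧ LipschitzWith M x} := by
  refine ArzelaAscoli.isCompact_of_equicontinuous _ ?_ ?_
  · have himage : ContinuousMap.toFun '' {x : C(ℝ, E) | x 0 = x₀ ∧ LipschitzWith M x} =
        {x : ℝ → E | x 0 = x₀} ∩ ⋂ (s : ℝ) (t : ℝ), {x | dist (x s) (x t) ≤ M * dist s t} := by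
      ext x
      simp only [mem_image, mem_ofPred_eq, mem_inter_iff, mem_iInter]
      constructor
      · rintro ⟨y, ⟨hy0, hy⟩, rfl⟩
        exact ⟨hy0, fun s t => hy.dist_le_mul s t⟩
      · rintro ⟨h0, h⟩
        have hx : LipschitzWith M x := LipschitzWith.of_dist_le_mul h
        exact ⟨⟨x, hx.continuous⟩, ⟨h0, hx⟩, rfl⟩
    have hclosed : IsClosed ({x : ℝ → E | x 0 = x₀} ∩
        ⋂ (s : ℝ) (t : ℝ), {x | dist (x s) (x t) ≤ M * dist s t}) := by
      refine (isClosed_eq (continuous_apply 0) continuous_const).inter ?_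
      refine isClosed_iInter fun s => isClosed_iInter fun t => ?_
      exact isClosed_le ((continuous_apply s).dist (continuous_apply t)) continuous_const
    rw [himage]
    refine (isCompact_univ_pi fun t : ℝ =>
      isCompact_closedBall x₀ (M * dist t 0)).of_isClosed_subset hclosed ?_
    rintro x ⟨h0, h⟩ t -
    simp only [mem_iInter, mem_ofPred_eq] at h h0
    simpa [h0] using h t 0
  · refine (LipschitzWith.uniformEquicontinuous _ M ?_).equicontinuous
    exact fun x => x.2.2

variable [NormedSpace ℝ E]

/-- One step of the successive approximation of the solution of the delayed equation
`x'(t) = G(x(t - h))`. -/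
def delayStep (G : E → E) (hG : Continuous G) (x₀ : E) (h : ℝ) (x : C(ℝ, E)) : C(ℝ, E) where
  toFun t := x₀ + ∫ s in (0 : ℝ)..max t 0, G (x (s - h))
  continuous_toFun := by
    have hc : Continuous fun s => G (x (s - h)) := by fun_prop
    exact continuous_const.add
      ((intervalIntegral.continuous_primitive (fun a b => hc.intervalIntegrable a b) 0).comp
        (continuous_id.max continuous_const))

theorem delayStep_lipschitzWith {G : E → E} (hG : Continuous G) {M : ℝ≥0}
    (hM : ∀ y, ‖G y‖ ≤ M) (x₀ : E) (h : ℝ) (x : C(ℝ, E)) :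
    LipschitzWith M (delayStep G hG x₀ h x) := by
  have hc : Continuous fun s => G (x (s - h)) := by fun_prop
  refine LipschitzWith.of_dist_le_mul fun s t => ?_
  have hst : |max s 0 - max t 0| ≤ |s - t| := abs_max_sub_max_le_abs s t 0
  calc dist (delayStep G hG x₀ h x s) (delayStep G hG x₀ h x t)
      = ‖∫ r in (max t 0)..(max s 0), G (x (r - h))‖ := by
        rw [dist_eq_norm]
        simp only [delayStep, ContinuousMap.coe_mk, add_sub_add_left_eq_sub]
        rw [intervalIntegral.integral_interval_sub_left (hc.intervalIntegrable _ _)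
          (hc.intervalIntegrable _ _)]
    _ ≤ M * |max s 0 - max t 0| :=
        intervalIntegral.norm_integral_le_of_norm_le_const fun r _ => hM _
    _ ≤ M * dist s t := by
        rw [Real.dist_eq]; gcongr

/-- Method of steps: the right-hand side at time `t` sees the path only up to `t - h`, so each
iteration of `delayStep` fixes the path on a further interval of length `h`, and finitely many reach
`T`. -/
theorem exists_delayed_solution {G : E → E} (hG : Continuous G) {M : ℝ≥0}
    (hM : ∀ y, ‖G y‖ ≤ M) (x₀ : E) {h : ℝ} (hh : 0 < h) (T : ℝ) :
    ∃ x : C(ℝ, E), (x 0 = x₀ ∧ LipschitzWith M x) ∧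
      ∀ t ∈ Icc 0 T, x t = x₀ + ∫ s in (0 : ℝ)..t, G (x (s - h)) := by
  set φ : ℕ → C(ℝ, E) := fun j => (delayStep G hG x₀ h)^[j] (ContinuousMap.const ℝ x₀) with hφ
  have hsucc : ∀ j, φ (j + 1) = delayStep G hG x₀ h (φ j) := fun j =>
    Function.iterate_succ_apply' _ _ _
  have hval : ∀ j t, φ (j + 1) t = x₀ + ∫ s in (0 : ℝ)..max t 0, G (φ j (s - h)) := by
    intro j t; rw [hsucc]; rfl
  -- The base case rests on the `max` in `delayStep`: every iterate equals `x₀` at times `t ≤ 0`.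
  have hstable : ∀ j : ℕ, ∀ t ≤ j * h, φ (j + 1) t = φ j t := by
    intro j
    induction j with
    | zero =>
      intro t ht
      rw [hval, max_eq_right (by simpa using ht)]
      simp [hφ]
    | succ j ih =>
      intro t ht
      rw [hval, hval]
      congr 1
      refine intervalIntegral.integral_congr fun s hs => ?_
      rw [uIcc_of_le (le_max_right _ _)] at hs
      have hs' : s - h ≤ j * h := by
        have : s ≤ (j + 1 : ℕ) * h := hs.2.trans (max_le ht (by positivity))
        push_cast at this
        linarith
      simp only [ih _ hs']
  obtain ⟨j, hj⟩ := exists_nat_ge (T / h)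
  rw [div_le_iff₀ hh] at hj
  refine ⟨φ (j + 1), ⟨by simp [hval], hsucc j ▸ delayStep_lipschitzWith hG hM x₀ h _⟩, ?_⟩
  intro t ht
  rw [hval, max_eq_left ht.1]
  congr 1
  refine intervalIntegral.integral_congr fun s hs => ?_
  rw [uIcc_of_le ht.1] at hs
  simp only [hstable j (s - h) (by linarith [hs.2, ht.2])]

/-- **Peano's theorem**: a bounded continuous vector field has a solution on `[0, ∞)` from every
initial state. -/
theorem exists_isIntegralCurveOn_Ici [FiniteDimensional ℝ E] {G : E → E} (hG : Continuous G)
    {M : ℝ≥0} (hM : ∀ y, ‖G y‖ ≤ M) (x₀ : E) :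
    ∃ x : ℝ → E, x 0 = x₀ ∧ IsIntegralCurveOn x (fun _ => G) (Ici 0) := by
  have : ProperSpace E := FiniteDimensional.proper ℝ E
  choose a ha hsol using fun k : ℕ =>
    exists_delayed_solution hG hM x₀ (h := 1 / ((k : ℝ) + 1)) (by positivity) k
  obtain ⟨x, hx, φ, hφ, hlim⟩ := (isCompact_setOf_lipschitzWith x₀ M).tendsto_subseq ha
  have hpt : ∀ t, Tendsto (fun k => a (φ k) t) atTop (𝓝 (x t)) := fun t =>
    ((ContinuousEvalConst.continuous_eval_const t).tendsto x).comp hlim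
  -- The common Lipschitz constant makes the vanishing delay harmless in the limit.
  have hdelay : ∀ t, Tendsto (fun k => a (φ k) (t - 1 / ((φ k : ℝ) + 1))) atTop (𝓝 (x t)) := by
    intro t
    refine (hpt t).congr_dist ?_
    have h0 : Tendsto (fun k => (M : ℝ) * (1 / ((φ k : ℝ) + 1))) atTop (𝓝 0) := by
      simpa using (tendsto_one_div_add_atTop_nhds_zero_nat.comp hφ.tendsto_atTop).const_mul (M : ℝ)
    refine squeeze_zero (fun _ => dist_nonneg) (fun k => ?_) h0
    refine ((ha (φ k)).2.dist_le_mul _ _).trans_eq ?_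
    rw [Real.dist_eq, sub_sub_cancel, abs_of_pos (by positivity)]
  have hint : ∀ t ∈ Ici (0 : ℝ), x t = x₀ + ∫ s in (0 : ℝ)..t, G (x s) := by
    intro t ht
    have hconv : Tendsto (fun k => ∫ s in (0 : ℝ)..t, G (a (φ k) (s - 1 / ((φ k : ℝ) + 1)))) atTop
        (𝓝 (∫ s in (0 : ℝ)..t, G (x s))) := by
      refine intervalIntegral.tendsto_integral_filter_of_dominated_convergence (fun _ => (M : ℝ))
        (Eventually.of_forall fun k => ?_) (Eventually.of_forall fun k => ?_)
        intervalIntegrable_const (Eventually.of_forall fun s _ => ?_)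
      · exact Continuous.aestronglyMeasurable (by fun_prop)
      · exact Eventually.of_forall fun s _ => hM _
      · exact (hG.tendsto _).comp (hdelay s)
    refine tendsto_nhds_unique (hpt t) ((hconv.const_add x₀).congr' ?_)
    -- The `k`-th path solves its delayed equation only on `[0, k]`, which contains `t` eventually.
    filter_upwards [(tendsto_natCast_atTop_atTop.comp hφ.tendsto_atTop).eventually_ge_atTop t]
      with k hk
    exact (hsol (φ k) t ⟨ht, hk⟩).symm
  refine ⟨x, hx.1, fun t ht => ?_⟩
  have hc : Continuous fun s => G (x s) := by fun_prop
  have hd : HasDerivAt (fun t => x₀ + ∫ s in (0 : ℝ)..t, G (x s)) (G (x t)) t :=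
    (intervalIntegral.integral_hasDerivAt_right (hc.intervalIntegrable _ _)
      hc.aestronglyMeasurable.stronglyMeasurableAtFilter hc.continuousAt).const_add x₀
  exact hd.hasDerivWithinAt.congr hint (hint t ht)

end Peano

/-! ### Sublevel sets of a strict Lyapunov function -/

/-- `V` is a `C¹` positive definite function with bounded sublevel set `{V ≤ γ}`, on which `F` is
continuous and, off the origin, `V` decreases strictly along `F`. -/
structure IsStrictLyapunov {n : ℕ} (F : Vec n → Vec n) (V : Vec n → ℝ) (γ : ℝ) : Prop where
  contDiff : ContDiff ℝ 1 V
  zero : V 0 = 0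
  pos : ∀ x, x ≠ 0 → 0 < V x
  level_pos : 0 < γ
  bounded : Bornology.IsBounded {x | V x ≤ γ}
  continuousOn : ContinuousOn F {x | V x ≤ γ}
  decrease : ∀ x, V x ≤ γ → x ≠ 0 → fderiv ℝ V x (F x) < 0

theorem IsSolutionFrom.mono {n : ℕ} {F : Vec n → Vec n} {x₀ : Vec n} {J J' : Set ℝ}
    {x : ℝ → Vec n} (h : IsSolutionFrom F x₀ J x) (hJ : J' ⊆ J) : IsSolutionFrom F x₀ J' x :=
  ⟨h.1, h.2.mono hJ⟩

theorem IsSolutionFrom.continuousOn {n : ℕ} {F : Vec n → Vec n} {x₀ : Vec n} {J : Set ℝ}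
    {x : ℝ → Vec n} (h : IsSolutionFrom F x₀ J x) : ContinuousOn x J :=
  fun t ht => (h.2 t ht).continuousWithinAt

theorem IsSolutionFrom.shift {n : ℕ} {F : Vec n → Vec n} {x₀ : Vec n} {x : ℝ → Vec n}
    (h : IsSolutionFrom F x₀ (Ici 0) x) {a : ℝ} (ha : 0 ≤ a) :
    IsSolutionFrom F (x a) (Ici 0) fun t => x (t + a) := by
  refine ⟨by simp, fun t ht => ?_⟩
  have hx := h.2 (t + a) (add_nonneg ht ha)
  have hs : HasDerivWithinAt (fun t : ℝ => t + a) 1 (Ici 0) t :=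
    ((hasDerivAt_id t).add_const a).hasDerivWithinAt
  have hd := hx.scomp t hs fun s hs => add_nonneg hs ha
  rwa [one_smul] at hd

namespace IsStrictLyapunov

variable {n : ℕ} {F : Vec n → Vec n} {V : Vec n → ℝ} {γ : ℝ}

theorem eq_zero_of_le (hV : IsStrictLyapunov F V γ) {x : Vec n} (hx : V x ≤ 0) : x = 0 := by
  by_contra h
  exact hx.not_gt (hV.pos x h)

theorem isCompact_sublevel (hV : IsStrictLyapunov F V γ) : IsCompact {x | V x ≤ γ} :=
  Metric.isCompact_of_isClosed_isBounded
    (isClosed_le hV.contDiff.continuous continuous_const) hV.bounded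

theorem hasDerivWithinAt_comp (hV : IsStrictLyapunov F V γ) {x₀ : Vec n} {b : ℝ} {x : ℝ → Vec n}
    (hx : IsSolutionFrom F x₀ (Icc 0 b) x) {t : ℝ} (ht : t ∈ Ico 0 b) :
    HasDerivWithinAt (fun s => V (x s)) (fderiv ℝ V (x t) (F (x t))) (Ici t) t := by
  have hd : HasDerivWithinAt x (F (x t)) (Ici t) t :=
    (hx.2 t (Ico_subset_Icc_self ht)).mono_of_mem_nhdsWithin
      (mem_of_superset (Icc_mem_nhdsGE ht.2) (Icc_subset_Icc_left ht.1))
  exact ((hV.contDiff.differentiable one_ne_zero).differentiableAt.hasFDerivAt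
    (x := x t)).comp_hasDerivWithinAt t hd

/-- At a time when `V = c`, positivity of `c` keeps the state off the origin, so `V` is strictly
decreasing there and cannot cross the level. -/
theorem sublevel_invariant (hV : IsStrictLyapunov F V γ) {x₀ : Vec n} {b c : ℝ} {x : ℝ → Vec n}
    (hx : IsSolutionFrom F x₀ (Icc 0 b) x) (hc : 0 < c) (hcγ : c ≤ γ) (h₀ : V x₀ ≤ c)
    {t : ℝ} (ht : t ∈ Icc 0 b) : V (x t) ≤ c := by
  refine image_le_of_deriv_right_lt_deriv_boundary' (f := fun s => V (x s)) (B := fun _ => c)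
    (B' := fun _ => 0) (hV.contDiff.continuous.comp_continuousOn hx.continuousOn)
    (fun s hs => hV.hasDerivWithinAt_comp hx hs) (by simpa [hx.1] using h₀) continuousOn_const
    (fun s _ => hasDerivWithinAt_const _ _ _) (fun s _ hs => ?_) ht
  refine hV.decrease _ (hs.trans_le hcγ) fun h => ?_
  simp only [h, hV.zero] at hs
  exact hc.ne hs

theorem sublevel_invariant_Ici (hV : IsStrictLyapunov F V γ) {x₀ : Vec n} {c : ℝ} {x : ℝ → Vec n}
    (hx : IsSolutionFrom F x₀ (Ici 0) x) (hc : 0 < c) (hcγ : c ≤ γ) (h₀ : V x₀ ≤ c)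
    {t : ℝ} (ht : 0 ≤ t) : V (x t) ≤ c :=
  hV.sublevel_invariant (hx.mono Icc_subset_Ici_self) hc hcγ h₀ (right_mem_Icc.2 ht)

theorem sublevel_invariant_Ico (hV : IsStrictLyapunov F V γ) {x₀ : Vec n} {T c : ℝ}
    {x : ℝ → Vec n} (hx : IsSolutionFrom F x₀ (Ico 0 T) x) (hc : 0 < c) (hcγ : c ≤ γ)
    (h₀ : V x₀ ≤ c) {t : ℝ} (ht : t ∈ Ico 0 T) : V (x t) ≤ c :=
  hV.sublevel_invariant (hx.mono fun _ hs => ⟨hs.1, hs.2.trans_lt ht.2⟩) hc hcγ h₀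
    (right_mem_Icc.2 ht.1)

/-! ### Existence and continuation of solutions in the sublevel set -/

theorem exists_bound (hV : IsStrictLyapunov F V γ) :
    ∃ M : ℝ≥0, ∀ x, V x ≤ γ → ‖F x‖ ≤ M := by
  obtain ⟨C, hC⟩ := hV.isCompact_sublevel.exists_bound_of_continuousOn hV.continuousOn
  exact ⟨C.toNNReal, fun x hx => (hC x hx).trans (Real.le_coe_toNNReal C)⟩

/-- Tietze extends `F` from the compact sublevel set to a bounded continuous `G`, to which Peano's
theorem applies. `V` is a strict Lyapunov function for `G` too, so the solution never leaves the set
where `G = F`. -/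
theorem exists_solution (hV : IsStrictLyapunov F V γ) {x₀ : Vec n} (h₀ : V x₀ ≤ γ) :
    ∃ x, IsSolutionFrom F x₀ (Ici 0) x := by
  set R : Set (Vec n) := {x | V x ≤ γ}
  have hcomp : IsCompact R := hV.isCompact_sublevel
  have : CompactSpace R := isCompact_iff_compactSpace.1 hcomp
  let Fr : C(R, Vec n) := ⟨R.domRestrict F, hV.continuousOn.domRestrict⟩
  obtain ⟨G, -, hG⟩ := BoundedContinuousFunction.exists_norm_eq_domRestrict_eq hcomp.isClosed ℝ
    (BoundedContinuousFunction.mkOfCompact Fr)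
  have hGF : ∀ x, V x ≤ γ → G x = F x := fun x hx => congr($hG ⟨x, hx⟩)
  have hVG : IsStrictLyapunov G V γ :=
    { hV with
      continuousOn := G.continuous.continuousOn
      decrease := fun x hx h => by rw [hGF x hx]; exact hV.decrease x hx h }
  obtain ⟨x, hx0, hx⟩ := exists_isIntegralCurveOn_Ici G.continuous (M := ‖G‖₊)
    (fun y => G.norm_coe_le_norm y) x₀
  refine ⟨x, hx0, fun t ht => ?_⟩
  have := hx t ht
  beta_reduce at this
  rwa [hGF _ (hVG.sublevel_invariant_Ici ⟨hx0, hx⟩ hV.level_pos le_rfl h₀ ht)] at this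

/-- A solution from `0` stays in every sublevel set of positive level, hence is constant, and its
derivative at time `0` is `F 0`. -/
theorem map_zero (hV : IsStrictLyapunov F V γ) : F 0 = 0 := by
  have h0 : V 0 ≤ γ := hV.zero.trans_le hV.level_pos.le
  obtain ⟨x, hx⟩ := hV.exists_solution h0
  have hzero : ∀ t ∈ Ici (0 : ℝ), x t = 0 := by
    intro t ht
    refine hV.eq_zero_of_le (le_of_forall_pos_le_add fun c hc => ?_)
    have := hV.sublevel_invariant_Ici hx (lt_min hc hV.level_pos) (min_le_right _ _)
      (hV.zero.trans_le (lt_min hc hV.level_pos).le) ht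
    linarith [min_le_left c γ]
  have hd := hx.2 0 self_mem_Ici
  rw [hx.1] at hd
  exact ((uniqueDiffOn_Ici (0 : ℝ)) 0 self_mem_Ici).eq_deriv _ hd
    ((hasDerivWithinAt_const (0 : ℝ) (Ici 0) (0 : Vec n)).congr hzero hx.1)

/-- `F` is bounded on the sublevel set, so the solution is Lipschitz and satisfies the Cauchy
criterion at `T`. -/
theorem exists_tendsto_left (hV : IsStrictLyapunov F V γ) {x₀ : Vec n} (h₀ : V x₀ ≤ γ) {T : ℝ}
    (hT : 0 < T) {x : ℝ → Vec n} (hx : IsSolutionFrom F x₀ (Ico 0 T) x) :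
    ∃ L, V L ≤ γ ∧ Tendsto x (𝓝[<] T) (𝓝 L) := by
  obtain ⟨M, hM⟩ := hV.exists_bound
  have hlip : LipschitzOnWith M x (Ico 0 T) :=
    (convex_Ico 0 T).lipschitzOnWith_of_nnnorm_hasDerivWithin_le hx.2 fun t ht =>
      hM _ (hV.sublevel_invariant_Ico hx hV.level_pos le_rfl h₀ ht)
  have hmem : Ico 0 T ∈ 𝓝[<] T := Ico_mem_nhdsLT hT
  have hcauchy : Cauchy (map x (𝓝[<] T)) :=
    (cauchy_nhds.mono nhdsWithin_le_nhds).map_of_le hlip.uniformContinuousOn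
      (le_principal_iff.2 hmem)
  obtain ⟨L, hL⟩ := CompleteSpace.complete hcauchy
  refine ⟨L, le_of_tendsto ((hV.contDiff.continuous.tendsto L).comp hL) ?_, hL⟩
  filter_upwards [hmem] with t ht
  exact hV.sublevel_invariant_Ico hx hV.level_pos le_rfl h₀ ht

theorem exists_continuation (hV : IsStrictLyapunov F V γ) {x₀ : Vec n} (h₀ : V x₀ ≤ γ) {T : ℝ}
    (hT : 0 < T) {x : ℝ → Vec n} (hx : IsSolutionFrom F x₀ (Ico 0 T) x) :
    ∃ y, IsSolutionFrom F x₀ (Ici 0) y ∧ EqOn x y (Ico 0 T) := by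
  obtain ⟨L, hL, hlim⟩ := hV.exists_tendsto_left h₀ hT hx
  obtain ⟨z, hz0, hz⟩ := hV.exists_solution hL
  set y : ℝ → Vec n := fun t => if t < T then x t else z (t - T) with hy
  have hyx : ∀ t < T, y t = x t := fun t ht => if_pos ht
  have hyz : ∀ t ∈ Ici T, y t = z (t - T) := fun t ht => if_neg (not_lt.2 ht)
  have hyT : y T = L := by rw [hyz T self_mem_Ici, sub_self, hz0]
  have hright : ∀ t ∈ Ici T, HasDerivWithinAt y (F (y t)) (Ici T) t := by
    intro t ht
    have hs : HasDerivWithinAt (fun t : ℝ => t - T) 1 (Ici T) t :=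
      ((hasDerivAt_id t).sub_const T).hasDerivWithinAt
    have hd := (hz (t - T) (mem_Ici.2 (sub_nonneg.2 ht))).scomp t hs
      fun s hs => mem_Ici.2 (sub_nonneg.2 hs)
    rw [one_smul] at hd
    rw [hyz t ht]
    exact hd.congr hyz (hyz t ht)
  have hleft : ∀ t ∈ Ioo 0 T, HasDerivAt y (F (y t)) t := by
    intro t ht
    have hd : HasDerivAt x (F (x t)) t :=
      (hx.2 t (Ioo_subset_Ico_self ht)).hasDerivAt (Ico_mem_nhds ht.1 ht.2)
    rw [hyx t ht.2]
    exact hd.congr_of_eventuallyEq (eventually_of_mem (Iio_mem_nhds ht.2) hyx)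
  have hyIoo : ∀ t ∈ Ioo 0 T, V (y t) ≤ γ := fun t ht => by
    rw [hyx t ht.2]
    exact hV.sublevel_invariant_Ico hx hV.level_pos le_rfl h₀ (Ioo_subset_Ico_self ht)
  have hylim : Tendsto y (𝓝[<] T) (𝓝 (y T)) := by
    rw [hyT]
    exact hlim.congr' (eventually_of_mem self_mem_nhdsWithin fun t ht => (hyx t ht).symm)
  have hmem : Ioo 0 T ∈ 𝓝[<] T := Ioo_mem_nhdsLT hT
  -- Differentiability at the gluing time: the left derivative at `T` is the limit of the
  -- derivatives `F (y t)`, by continuity of `F` within the sublevel set.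
  have hderivT : HasDerivWithinAt y (F (y T)) (Iic T) T := by
    refine hasDerivWithinAt_Iic_of_tendsto_deriv (s := Ioo 0 T)
      (fun t ht => (hleft t ht).differentiableAt.differentiableWithinAt)
      (hylim.mono_left (nhdsWithin_mono _ fun t ht => ht.2)) hmem ?_
    have hF : Tendsto F (𝓝[{x | V x ≤ γ}] (y T)) (𝓝 (F (y T))) := by
      rw [hyT]; exact hV.continuousOn L hL
    refine (hF.comp (tendsto_nhdsWithin_iff.2 ⟨hylim, eventually_of_mem hmem hyIoo⟩)).congr' ?_
    exact eventually_of_mem hmem fun t ht => (hleft t ht).deriv.symm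
  refine ⟨y, ⟨by rw [hyx 0 hT, hx.1], fun t ht => ?_⟩, fun t ht => (hyx t ht.2).symm⟩
  rcases lt_trichotomy t T with h | rfl | h
  · have hd : HasDerivWithinAt x (F (x t)) (Ici 0) t :=
      (hx.2 t ⟨ht, h⟩).mono_of_mem_nhdsWithin
        (inter_mem_nhdsWithin (Ici 0) (Iio_mem_nhds h))
    rw [hyx t h]
    exact hd.congr_of_eventuallyEq
      (nhdsWithin_le_nhds (eventually_of_mem (Iio_mem_nhds h) hyx)) (hyx t h)
  · have := hderivT.union (hright t self_mem_Ici)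
    rw [Iic_union_Ici] at this
    exact this.mono (subset_univ _)
  · exact ((hright t h.le).hasDerivAt (Ici_mem_nhds h)).hasDerivWithinAt

/-! ### Stability and attraction -/

theorem exists_level_norm_lt (hV : IsStrictLyapunov F V γ) {ε : ℝ} (hε : 0 < ε) :
    ∃ c, 0 < c ∧ c ≤ γ ∧ ∀ x, V x ≤ c → ‖x‖ < ε := by
  have hK : IsCompact ({x | V x ≤ γ} ∩ {x : Vec n | ε ≤ ‖x‖}) :=
    hV.isCompact_sublevel.inter_right (isClosed_le continuous_const continuous_norm)
  rcases eq_empty_or_nonempty ({x | V x ≤ γ} ∩ {x : Vec n | ε ≤ ‖x‖}) with hE | hne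
  · refine ⟨γ, hV.level_pos, le_rfl, fun x hx => not_le.1 fun h => ?_⟩
    exact (hE ▸ (⟨hx, h⟩ : x ∈ {x | V x ≤ γ} ∩ {x : Vec n | ε ≤ ‖x‖}) : x ∈ (∅ : Set (Vec n)))
  · obtain ⟨p, hp, hmin⟩ := hK.exists_isMinOn hne hV.contDiff.continuous.continuousOn
    have hpos : 0 < V p := hV.pos p (norm_pos_iff.1 (hε.trans_le hp.2))
    -- Half the minimum of `V` over the far part of the sublevel set is a level that no far point
    -- attains.
    refine ⟨min γ (V p / 2), lt_min hV.level_pos (half_pos hpos), min_le_left _ _, ?_⟩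
    intro x hx
    by_contra! h
    have : V p ≤ V x := hmin ⟨hx.trans (min_le_left _ _), h⟩
    linarith [min_le_right γ (V p / 2)]

theorem sublevel_mem_nhds (hV : IsStrictLyapunov F V γ) {c : ℝ} (hc : 0 < c) :
    {x | V x ≤ c} ∈ 𝓝 0 :=
  (hV.contDiff.continuous.tendsto 0).eventually (Iic_mem_nhds (by rwa [hV.zero]))

theorem isLyapunovStable (hV : IsStrictLyapunov F V γ) : IsLyapunovStable F := by
  intro ε hε
  obtain ⟨c, hc, hcγ, hcε⟩ := hV.exists_level_norm_lt hε
  obtain ⟨ρ, hρ, hball⟩ := Metric.mem_nhds_iff.1 (hV.sublevel_mem_nhds hc)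
  refine ⟨ρ, hρ, fun x₀ hx₀ T _ x hx t ht => hcε _ ?_⟩
  exact hV.sublevel_invariant_Ico hx hc hcγ (hball (by simpa using hx₀)) ht

/-- A solution in `{V ≤ γ}` enters every smaller sublevel set: outside of it, `V` decreases at a
rate bounded away from zero. -/
theorem exists_time_lt (hV : IsStrictLyapunov F V γ) {x₀ : Vec n} (h₀ : V x₀ ≤ γ)
    {x : ℝ → Vec n} (hx : IsSolutionFrom F x₀ (Ici 0) x) {c : ℝ} (hc : 0 < c) :
    ∃ t, 0 ≤ t ∧ V (x t) < c := by
  by_contra! hge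
  have hmem : ∀ t, 0 ≤ t → x t ∈ {x | V x ≤ γ} ∩ {x | c ≤ V x} := fun t ht =>
    ⟨hV.sublevel_invariant_Ici hx hV.level_pos le_rfl h₀ ht, hge t ht⟩
  have hK : IsCompact ({x | V x ≤ γ} ∩ {x | c ≤ V x}) :=
    hV.isCompact_sublevel.inter_right (isClosed_le continuous_const hV.contDiff.continuous)
  have hcont : ContinuousOn (fun x => fderiv ℝ V x (F x)) ({x | V x ≤ γ} ∩ {x | c ≤ V x}) :=
    (hV.contDiff.continuous_fderiv one_ne_zero).continuousOn.clm_apply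
      (hV.continuousOn.mono inter_subset_left)
  -- The slowest rate of decrease on the compact set `c ≤ V ≤ γ` is attained, hence strictly
  -- negative.
  obtain ⟨p, hp, hmax⟩ := hK.exists_isMaxOn ⟨x 0, hmem 0 le_rfl⟩ hcont
  have hneg : fderiv ℝ V p (F p) < 0 := by
    refine hV.decrease p hp.1 fun h => ?_
    have hcp : c ≤ V p := hp.2
    rw [h, hV.zero] at hcp
    exact hc.not_ge hcp
  set a := fderiv ℝ V p (F p) with ha
  have hle : ∀ b, 0 ≤ b → V (x b) ≤ γ + a * b := by
    intro b hb
    have hxb : IsSolutionFrom F x₀ (Icc 0 b) x := hx.mono Icc_subset_Ici_self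
    refine image_le_of_deriv_right_le_deriv_boundary (f := fun s => V (x s))
      (B := fun s => γ + a * s) (B' := fun _ => a)
      (hV.contDiff.continuous.comp_continuousOn hxb.continuousOn)
      (fun s hs => hV.hasDerivWithinAt_comp hxb hs) (by simpa [hx.1] using h₀)
      (by fun_prop) (fun s _ => ?_) (fun s hs => hmax (hmem s hs.1)) (right_mem_Icc.2 hb)
    simpa using (((hasDerivAt_id s).const_mul a).const_add γ).hasDerivWithinAt
  -- At time `γ / -a` the linear bound `γ + a * b` reaches `0`, contradicting `V ≥ c > 0`.
  have hb : 0 ≤ γ / -a := div_nonneg hV.level_pos.le (neg_nonneg.2 hneg.le)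
  have h1 := hle _ hb
  have h2 := hge _ hb
  have h3 : a * (γ / -a) = -γ := by
    rw [div_neg, mul_neg, mul_div_cancel₀ _ hneg.ne]
  linarith

/-- After entering a small sublevel set, the solution restarted from that time is trapped in it, as
the field is autonomous. -/
theorem tendsto_zero (hV : IsStrictLyapunov F V γ) {x₀ : Vec n} (h₀ : V x₀ ≤ γ)
    {x : ℝ → Vec n} (hx : IsSolutionFrom F x₀ (Ici 0) x) : Tendsto x atTop (𝓝 0) := by
  rw [Metric.tendsto_atTop]
  intro ε hε
  obtain ⟨c, hc, hcγ, hcε⟩ := hV.exists_level_norm_lt hε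
  obtain ⟨a, ha, hac⟩ := hV.exists_time_lt h₀ hx hc
  refine ⟨a, fun t hta => ?_⟩
  rw [dist_zero_right]
  have := hV.sublevel_invariant_Ici (hx.shift ha) hc hcγ hac.le (sub_nonneg.2 hta)
  exact hcε _ (by simpa using this)

theorem isROAInnerApprox (hV : IsStrictLyapunov F V γ) : IsROAInnerApprox F {x | V x ≤ γ} := by
  have hsub : {x | V x ≤ γ} ⊆ regionOfAttraction F := fun x₀ h₀ =>
    ⟨hV.exists_solution h₀, fun _ hT _ hx => hV.exists_continuation h₀ hT hx,
      fun _ hx => hV.tendsto_zero h₀ hx⟩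
  exact ⟨⟨hV.map_zero, hV.isLyapunovStable,
    mem_of_superset (hV.sublevel_mem_nhds hV.level_pos) hsub⟩, hsub⟩

end IsStrictLyapunov

/-! ### From the robust decrease condition to the true closed loop -/

open Classical in
/-- Under the confidence bound, the model error is one of the admissible disturbances, so the
robust Lyapunov function decreases along the true closed loop. -/
theorem IsRobustLyapunov.isStrictLyapunov {n m : ℕ} {f : Fin n → MvPolynomial (Fin n) ℝ}
    {g : Matrix (Fin n) (Fin m) (MvPolynomial (Fin n) ℝ)} {w μ : Vec n → Vec n}
    {σ : Fin n → Vec n → ℝ} {sβ : Fin n → ℝ≥0∞} {η : ℝ≥0} {κ : Vec n → Vec m} {V : Vec n → ℝ}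
    {γ : ℝ} (hV : IsRobustLyapunov f g μ σ η κ V γ) (hσ : ∀ i x, 0 ≤ σ i x) (hγ : 0 < γ)
    (hconf : ConfidenceBound w μ σ sβ η {x | V x ≤ γ})
    (hcont : ContinuousOn (closedLoop f g w κ) {x | V x ≤ γ}) :
    IsStrictLyapunov (closedLoop f g w κ) V γ where
  contDiff := hV.contDiff
  zero := hV.zero
  pos := hV.pos
  level_pos := hγ
  bounded := hV.bounded
  continuousOn := hcont
  decrease x hx hx0 := by
    -- Admissibility is required at every point but the confidence bound holds only on the sublevel
    -- set, so the error is cut off to `0` outside it.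
    have h := hV.decrease (fun y => if V y ≤ γ then w y - μ y else 0) (fun y i => ?_) x hx hx0
    · simp only [if_pos hx] at h
      convert h using 2
      simp only [closedLoop, openLoop]
      abel
    · rw [← abs_le]
      split_ifs with hy
      · refine ((hconf i).2 y hy).trans ?_
        gcongr
        · exact hσ i y
        -- The bound by the finite `η` also excludes `sβ i = ∞`, where `toReal` would give `0`.
        · exact ENNReal.toReal_mono ENNReal.coe_ne_top (hconf i).1
      · simpa using mul_nonneg η.2 (hσ i y)

/-- The exceptional set is null but perhaps not measurable; removing its measurable hull keeps the
event measurable and its probability unchanged. -/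
theorem HoldsWithProbGE.mono_ae {Ω : Type*} [MeasurableSpace Ω] {P : Measure Ω} {p : ℝ}
    {Q Q' : Ω → Prop} (hQ : HoldsWithProbGE P p Q) (h : ∀ᵐ ω ∂P, Q ω → Q' ω) :
    HoldsWithProbGE P p Q' := by
  obtain ⟨S, hS, hp, hSQ⟩ := hQ
  refine ⟨S \ toMeasurable P {ω | ¬(Q ω → Q' ω)}, hS.diff (measurableSet_toMeasurable _ _), ?_, ?_⟩
  · rwa [measure_sdiff_null ((measure_toMeasurable _).trans (ae_iff.1 h))]
  · intro ω hω
    have hω' : ω ∉ {ω | ¬(Q ω → Q' ω)} := fun hn => hω.2 (subset_toMeasurable _ _ hn)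
    exact not_not.1 hω' (hSQ ω hω.1)

end GPROA

end

theorem theorem1 {Ω : Type*} [MeasurableSpace Ω] (P : Measure Ω) [IsProbabilityMeasure P]
    {n m N : ℕ}
    (f : Fin n → MvPolynomial (Fin n) ℝ)
    (g : Matrix (Fin n) (Fin m) (MvPolynomial (Fin n) ℝ))
    (w : Ω → GPROA.Vec n → GPROA.Vec n)
    (D : Set (GPROA.Vec n)) (ε : ℝ) (hε : 0 < ε) (q : Ω → Fin n → MvPolynomial (Fin n) ℝ)
    (σn : ℝ) (X : Ω → Fin N → GPROA.Vec n) (U : Ω → Fin N → GPROA.Vec m)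
    (Y : Ω → Fin N → GPROA.Vec n)
    (hsys : ∀ᵐ ω ∂P,
      GPROA.StandingAssumptions f g (w ω) D ε (q ω) σn (X ω) (U ω) (Y ω))
    (k : Fin n → GPROA.PolyKernel n) (lam : ℝ) (hlam : 0 < lam)
    (δ : ℝ) (hδ : δ ∈ Ioo (0 : ℝ) 1) (η : ℝ≥0)
    (κ : Ω → GPROA.Vec n → GPROA.Vec m) (V : Ω → GPROA.Vec n → ℝ)
    (γ : Ω → ℝ) (hγ : ∀ᵐ ω ∂P, 0 < γ ω)
    (hconf : GPROA.HoldsWithProbGE P (1 - δ) fun ω =>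
      GPROA.ConfidenceBound (w ω) (GPROA.postMean f g k lam (X ω) (U ω) (Y ω))
        (fun i => GPROA.gpStd (k i) lam (X ω))
        (fun i => GPROA.sqrtBeta (k i) lam D N δ fun x => GPROA.polyField (q ω) x i)
        η {x | V ω x ≤ γ ω})
    (hlyap : ∀ᵐ ω ∂P,
      GPROA.IsRobustLyapunov f g (GPROA.postMean f g k lam (X ω) (U ω) (Y ω))
        (fun i => GPROA.gpStd (k i) lam (X ω)) η (κ ω) (V ω) (γ ω))
    (hcont : ∀ᵐ ω ∂P,
      ContinuousOn (GPROA.closedLoop f g (w ω) (κ ω)) {x | V ω x ≤ γ ω}) :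
    GPROA.HoldsWithProbGE P (1 - δ) fun ω =>
      GPROA.IsROAInnerApprox (GPROA.closedLoop f g (w ω) (κ ω)) {x | V ω x ≤ γ ω} := by
  refine hconf.mono_ae ?_
  filter_upwards [hγ, hlyap, hcont] with ω hγω hlyapω hcontω hconfω
  -- `gpStd` is a real square root, so it is nonnegative whatever the sign of `gpVar`.
  exact (hlyapω.isStrictLyapunov (fun i x => Real.sqrt_nonneg _) hγω hconfω
    hcontω).isROAInnerApprox
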